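/- For $n\ge 0$ let $P_n,Q_n,R_n$ be the derivative polynomials of $\tan$, $\sec$ and $\sec^2$, i.e. the (unique) real polynomials such that \[ \frac{d^n}{dx^n}\tan x=P_n(\tan x),\qquad \frac{d^n}{dx^n}\sec x=Q_n(\tan x)\,\sec x,\qquad \frac{d^n}{dx^n}\sec^2 x=R_n(\tan x)\,\sec^2 x \] for all real $x$ with $\cos x\neq 0$. A signed permutation of size $m$ is a permutation $\pi$ of $\{-m,\dots,-1\}\cup\{1,\dots,m\}$ such that $\pi(-i)=-\pi(i)$ for all $i$; write $\pi_i=\pi(i)$, and let $\mathrm{neg}(\pi)$ be the number of $i\in\{1,\dots,m\}$ with $\pi_i<0$. A cycle of $\pi$ is an unordered pair $\{O_1,O_2\}$ of (possibly equal) orbits of $\pi$ with $-O_1=O_2$. The signed permutation $\pi$ is cycle-alternating if every $i\in\{-m,\dots,-1\}\cup\{1,\dots,m\}$ satisfies either $\pi^{-1}(i)<i>\pi(i)$ or $\pi^{-1}(i)>i<\pi(i)$. Let $\mathcal C_m$ be the set of cycle-alternating signed permutations of size $m$, and let $\mathcal C_m^\circ\subset\mathcal C_m$ be the subset of those with exactly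 one cycle. Then for every integer $n\ge 0$, as polynomials in $t$, \[ P_n(t)=\sum_{\pi\in\mathcal C^\circ_{n+1}}t^{\mathrm{neg}(\pi)},\qquad Q_n(t)=\sum_{\pi\in\mathcal C_n}t^{\mathrm{neg}(\pi)},\qquad R_n(t)=\sum_{\substack{\pi\in\mathcal C^\circ_{n+2}\\ \pi_1>0}}t^{\mathrm{neg}(\pi)}. \] -/

import Mathlib

open Polynomial

/-- The index set `⟦n⟧ = {-n, …, -1} ∪ {1, …, n}`. -/
abbrev SignedIndex (n : ℕ) : Type :=
  {i : ℤ // i ∈ (Finset.Icc (-(n : ℤ)) (n : ℤ)).erase 0}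

/-- Negation `i ↦ -i` on `⟦n⟧`. -/
instance SignedIndex.instNeg (n : ℕ) : Neg (SignedIndex n) where
  neg i := ⟨-i.1, by
    have h := i.2
    simp only [Finset.mem_erase, Finset.mem_Icc] at h ⊢
    omega⟩

/-- The element `1` of `⟦n⟧`, for `n ≥ 1`. -/
def SignedIndex.first (n : ℕ) : SignedIndex (n + 1) :=
  ⟨1, by
    rw [Finset.mem_erase, Finset.mem_Icc]
    refine ⟨one_ne_zero, ?_, ?_⟩ <;> push_cast <;> linarith [Int.natCast_nonneg n]⟩

/-- Signed permutations of size `n`: the permutations `π` of `⟦n⟧` with `π(-i) = -π(i)`. -/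
abbrev SignedPerm (n : ℕ) : Type :=
  {π : Equiv.Perm (SignedIndex n) // ∀ i, π (-i) = -π i}

namespace SignedPerm

/-- `neg(π)`: the number of `i ∈ [n]` with `π(i) < 0`. -/
noncomputable def negCount {n : ℕ} (π : SignedPerm n) : ℕ :=
  (Finset.univ.filter fun i : SignedIndex n => 0 < i.1 ∧ (π.1 i).1 < 0).card

/-- The set of orbits of `π`. -/
def orbits {n : ℕ} (π : SignedPerm n) : Set (Set (SignedIndex n)) :=
  {O | ∃ x, O = {y | π.1.SameCycle x y}}

/-- The set of cycles of `π`: a cycle is an unordered pair `{O₁, O₂}` of orbits of `π`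
with `-O₁ = O₂` (the case `O₁ = O₂` is allowed). -/
def cycles {n : ℕ} (π : SignedPerm n) : Set (Sym2 (Set (SignedIndex n))) :=
  {c | ∃ O₁ ∈ π.orbits, ∃ O₂ ∈ π.orbits, (fun x => -x) '' O₁ = O₂ ∧ c = s(O₁, O₂)}

/-- `i` is a cycle peak of `π`: `π⁻¹(i) < i > π(i)`. -/
def IsCyclePeak {n : ℕ} (π : SignedPerm n) (i : SignedIndex n) : Prop :=
  π.1.symm i < i ∧ π.1 i < i

/-- `i` is a cycle valley of `π`: `π⁻¹(i) > i < π(i)`. -/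
def IsCycleValley {n : ℕ} (π : SignedPerm n) (i : SignedIndex n) : Prop :=
  i < π.1.symm i ∧ i < π.1 i

/-- `π` is cycle-alternating. -/
def CycleAlternating {n : ℕ} (π : SignedPerm n) : Prop :=
  ∀ i, π.IsCyclePeak i ∨ π.IsCycleValley i

end SignedPerm

open Classical in
/-- The set `𝒞_n` of cycle-alternating signed permutations of size `n`. -/
noncomputable def cycleAlternatingPerms (n : ℕ) : Finset (SignedPerm n) :=
  Finset.univ.filter fun π => π.CycleAlternating

open Classical in
/-- The set `𝒞°_n` of cycle-alternating signed permutations of size `n` with exactly one cycle. -/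
noncomputable def oneCycleAlternatingPerms (n : ℕ) : Finset (SignedPerm n) :=
  (cycleAlternatingPerms n).filter fun π => ∃! c, c ∈ π.cycles

/-- `p` is the `n`-th derivative polynomial of the tangent (`P_n`):
`(d/dx)^n tan x = p(tan x)` wherever `tan` is defined. -/
def IsTanDerivPoly (n : ℕ) (p : ℝ[X]) : Prop :=
  ∀ x : ℝ, Real.cos x ≠ 0 → iteratedDeriv n Real.tan x = p.eval (Real.tan x)

/-- `p` is the `n`-th derivative polynomial of `sec ^ a` (`Q_n` for `a = 1`, `R_n` for `a = 2`):
`(d/dx)^n sec^a x = p(tan x) sec^a x` wherever `sec` is defined. -/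
def IsSecPowDerivPoly (a n : ℕ) (p : ℝ[X]) : Prop :=
  ∀ x : ℝ, Real.cos x ≠ 0 →
    iteratedDeriv n (fun y : ℝ => (1 / Real.cos y) ^ a) x =
      p.eval (Real.tan x) * (1 / Real.cos x) ^ a

/-!
The tangent and secant polynomials satisfy `P₀ = t`, `P_{n+1} = (1 + t²) P_n'` and `Q₀ = 1`,
`Q_{n+1} = (1 + t²) Q_n' + t Q_n`, and `R_n = P_n'` because `sec² = tan'`. All three are determined
by their values at `tan x`, as `tan` is surjective. It therefore suffices to show that the
generating functions of cycle-alternating signed permutations satisfy the same recurrences.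

Shift a signed permutation `π` of size `n` to the index set `⟦n + 1⟧ \ {±1}`. For an index `e` such
that `e` and `π e` have opposite signs, replace the arc `e → π e` by the path `e → 1 → -π e`, and
symmetrically `-e → -π e` by `-e → -1 → π e`; this is `SignedPerm.insert`. Both `e` and `-π e` lie
on the same side of `1`, so `1` becomes a valley or a peak, and the target of the arc from `e`
changes from `π e` to `1` without a change of direction: the new permutation is alternating exactly
when `π` is (`SignedPerm.cycleAlternating_insert`). It has one cycle exactly when `π` has
(`SignedPerm.indecomposable_insert`). Conversely, every alternating permutation of size `n + 1`
arises in this way exactly once, unless it exchanges `1` and `-1`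
(`SignedPerm.CycleAlternating.exists_insert_eq`, `SignedPerm.insert_injective`); in that case
it is an alternating permutation of size `n` together with the cycle `1 ↔ -1`, so that `neg` is one
larger and there is more than one cycle if `n ≥ 1`.

There are `neg π` admissible `e > 0`, for which `neg` decreases by one and the image of `1` is
positive, and their negatives, for which `neg` increases by one and the image of `1` is negative.
Hence `π` contributes `neg π * (t ^ (neg π - 1) + t ^ (neg π + 1)) = (1 + t²) (t ^ neg π)'`, and
the part of it in which the image of `1` is positive is `(t ^ neg π)'`.
-/

/-! ### Derivative polynomials -/

theorem Polynomial.eq_of_eval_tan {p q : ℝ[X]}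
    (h : ∀ x : ℝ, Real.cos x ≠ 0 → p.eval (Real.tan x) = q.eval (Real.tan x)) : p = q := by
  refine Polynomial.funext fun t => ?_
  have := h (Real.arctan t) (Real.cos_arctan_pos t).ne'
  rwa [Real.tan_arctan] at this

theorem isTanDerivPoly_iff {n : ℕ} {p : ℝ[X]} (hp : IsTanDerivPoly n p) (q : ℝ[X]) :
    IsTanDerivPoly n q ↔ q = p := by
  refine ⟨fun hq => Polynomial.eq_of_eval_tan fun x hx => ?_, fun h => h ▸ hp⟩
  rw [← hq x hx, hp x hx]

theorem isSecPowDerivPoly_iff {a n : ℕ} {p : ℝ[X]} (hp : IsSecPowDerivPoly a n p) (q : ℝ[X]) :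
    IsSecPowDerivPoly a n q ↔ q = p := by
  refine ⟨fun hq => Polynomial.eq_of_eval_tan fun x hx => ?_, fun h => h ▸ hp⟩
  have h := (hq x hx).symm.trans (hp x hx)
  exact mul_right_cancel₀ (pow_ne_zero a (one_div_ne_zero hx)) h

theorem isTanDerivPoly_zero : IsTanDerivPoly 0 X := fun x _ => by simp

theorem isSecPowDerivPoly_zero (a : ℕ) : IsSecPowDerivPoly a 0 1 := fun x _ => by simp

theorem eventually_cos_ne_zero {x : ℝ} (hx : Real.cos x ≠ 0) :
    ∀ᶠ y in nhds x, Real.cos y ≠ 0 :=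
  Real.continuous_cos.continuousAt.eventually_ne hx

theorem one_div_cos_sq {x : ℝ} (hx : Real.cos x ≠ 0) :
    1 / Real.cos x ^ 2 = 1 + Real.tan x ^ 2 := by
  rw [Real.tan_eq_sin_div_cos]
  field_simp
  linarith [Real.sin_sq_add_cos_sq x]

theorem hasDerivAt_eval_tan (p : ℝ[X]) {x : ℝ} (hx : Real.cos x ≠ 0) :
    HasDerivAt (fun y => p.eval (Real.tan y))
      (p.derivative.eval (Real.tan x) * (1 + Real.tan x ^ 2)) x := by
  rw [← one_div_cos_sq hx]
  exact (p.hasDerivAt (Real.tan x)).comp x (Real.hasDerivAt_tan hx)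

theorem hasDerivAt_sec {x : ℝ} (hx : Real.cos x ≠ 0) :
    HasDerivAt (fun y => 1 / Real.cos y) (Real.tan x * (1 / Real.cos x)) x := by
  have h := (Real.hasDerivAt_cos x).inv hx
  simp only [one_div]
  refine h.congr_deriv ?_
  rw [Real.tan_eq_sin_div_cos]
  field_simp

theorem IsTanDerivPoly.succ {n : ℕ} {p : ℝ[X]} (hp : IsTanDerivPoly n p) :
    IsTanDerivPoly (n + 1) ((1 + X ^ 2) * derivative p) := by
  intro x hx
  have h : iteratedDeriv n Real.tan =ᶠ[nhds x] fun y => p.eval (Real.tan y) :=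
    (eventually_cos_ne_zero hx).mono hp
  rw [iteratedDeriv_succ, h.deriv_eq, (hasDerivAt_eval_tan p hx).deriv]
  simp
  ring

theorem IsSecPowDerivPoly.succ {a n : ℕ} {p : ℝ[X]} (hp : IsSecPowDerivPoly a n p) :
    IsSecPowDerivPoly a (n + 1) ((1 + X ^ 2) * derivative p + (a : ℝ[X]) * X * p) := by
  intro x hx
  have h : iteratedDeriv n (fun y : ℝ => (1 / Real.cos y) ^ a) =ᶠ[nhds x]
      fun y => p.eval (Real.tan y) * (1 / Real.cos y) ^ a :=
    (eventually_cos_ne_zero hx).mono hp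
  have hd := (hasDerivAt_eval_tan p hx).mul ((hasDerivAt_sec hx).pow a)
  have := hd.deriv
  rw [iteratedDeriv_succ, h.deriv_eq]
  refine this.trans ?_
  rcases a with _ | a
  · simp
    ring
  · simp only [Nat.add_sub_cancel, Pi.pow_apply, eval_add, eval_mul, eval_one, eval_pow, eval_X,
      eval_natCast, pow_succ (1 / Real.cos x) a]
    ring

/-- Since `sec² = tan'`, the derivative polynomials of `sec²` are the formal derivatives of
those of `tan`. -/
theorem IsTanDerivPoly.isSecPowDerivPoly_two {n : ℕ} {p : ℝ[X]} (hp : IsTanDerivPoly n p) :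
    IsSecPowDerivPoly 2 n (derivative p) := by
  intro x hx
  -- both sides of `deriv tan = 1 / cos ^ 2` vanish at the zeros of `cos`
  have h : (fun y : ℝ => (1 / Real.cos y) ^ 2) = deriv Real.tan := by
    ext y
    rw [Real.deriv_tan, one_div_pow]
  rw [h, ← iteratedDeriv_succ', hp.succ x hx, one_div_pow, one_div_cos_sq hx]
  simp
  ring

/-! ### The index set -/

namespace SignedIndex

variable {n : ℕ}

@[simp] theorem coe_neg (i : SignedIndex n) : ((-i : SignedIndex n) : ℤ) = -(i : ℤ) := rfl

@[simp] theorem coe_first : ((first n : SignedIndex (n + 1)) : ℤ) = 1 := rfl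

instance : InvolutiveNeg (SignedIndex n) where
  neg_neg i := Subtype.ext (neg_neg (i : ℤ))

theorem bounds (i : SignedIndex n) : (i : ℤ) ≠ 0 ∧ -(n : ℤ) ≤ i ∧ (i : ℤ) ≤ n := by
  have h := i.2
  rwa [Finset.mem_erase, Finset.mem_Icc] at h

instance isEmpty_zero : IsEmpty (SignedIndex 0) := ⟨fun i => by
  have := i.bounds
  push_cast at this
  omega⟩

theorem neg_ne_self (i : SignedIndex n) : -i ≠ i := fun h => by
  have := congrArg Subtype.val h
  have := i.bounds
  simp only [coe_neg] at *
  omega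

theorem pos_or_neg (i : SignedIndex n) : (0 < (i : ℤ) ∧ ¬ (i : ℤ) < 0) ∨
    ((i : ℤ) < 0 ∧ ¬ 0 < (i : ℤ)) := by
  have := i.bounds
  omega

/-- The inclusion of `⟦n⟧` into `⟦n + 1⟧` that increases every absolute value by one. -/
def shift (i : SignedIndex n) : SignedIndex (n + 1) :=
  ⟨if 0 < (i : ℤ) then i + 1 else i - 1, by
    have := i.bounds
    rw [Finset.mem_erase, Finset.mem_Icc]
    push_cast
    split_ifs <;> omega⟩

theorem coe_shift (i : SignedIndex n) :
    (shift i : ℤ) = if 0 < (i : ℤ) then (i : ℤ) + 1 else (i : ℤ) - 1 := rfl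

@[simp] theorem shift_neg (i : SignedIndex n) : shift (-i) = -shift i := by
  apply Subtype.ext
  have := i.bounds
  simp only [coe_shift, coe_neg]
  split_ifs <;> omega

@[simp] theorem shift_lt_shift {i j : SignedIndex n} : shift i < shift j ↔ i < j := by
  rw [← Subtype.coe_lt_coe, ← Subtype.coe_lt_coe]
  have := i.bounds
  have := j.bounds
  simp only [coe_shift]
  split_ifs <;> omega

@[simp] theorem shift_inj {i j : SignedIndex n} : shift i = shift j ↔ i = j := by
  rw [Subtype.ext_iff, Subtype.ext_iff]
  have := i.bounds
  have := j.bounds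
  simp only [coe_shift]
  split_ifs <;> omega

theorem shift_injective : Function.Injective (shift (n := n)) := fun _ _ => shift_inj.1

@[simp] theorem coe_shift_pos {i : SignedIndex n} : 0 < (shift i : ℤ) ↔ 0 < (i : ℤ) := by
  have := i.bounds
  simp only [coe_shift]
  split_ifs <;> omega

@[simp] theorem coe_shift_neg {i : SignedIndex n} : (shift i : ℤ) < 0 ↔ (i : ℤ) < 0 := by
  have := i.bounds
  simp only [coe_shift]
  split_ifs <;> omega

@[simp] theorem shift_ne_first (i : SignedIndex n) : shift i ≠ first n := fun h => by
  have := congrArg Subtype.val h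
  have := i.bounds
  simp only [coe_shift, coe_first] at *
  split_ifs at * <;> omega

@[simp] theorem shift_ne_neg_first (i : SignedIndex n) : shift i ≠ -first n := fun h =>
  shift_ne_first (-i) (by rw [shift_neg, h, neg_neg])

theorem shift_lt_first {i : SignedIndex n} : shift i < first n ↔ (i : ℤ) < 0 := by
  rw [← Subtype.coe_lt_coe]
  have := i.bounds
  simp only [coe_shift, coe_first]
  split_ifs <;> omega

theorem first_lt_shift {i : SignedIndex n} : first n < shift i ↔ 0 < (i : ℤ) := by
  rw [← Subtype.coe_lt_coe]
  have := i.bounds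
  simp only [coe_shift, coe_first]
  split_ifs <;> omega

theorem neg_lt_neg {i j : SignedIndex n} : -i < -j ↔ j < i := by
  simp only [← Subtype.coe_lt_coe, coe_neg, neg_lt_neg_iff]

/-- A left inverse of `shift`: the inverse on `⟦n + 1⟧ \ {±1}`, extended to `±1` by the
value `e`. -/
def unshift (e : SignedIndex n) (x : SignedIndex (n + 1)) : SignedIndex n :=
  if h : (x : ℤ) = 1 ∨ (x : ℤ) = -1 then e else
    ⟨if 0 < (x : ℤ) then x - 1 else x + 1, by
      have := x.bounds
      push_cast at this
      rw [Finset.mem_erase, Finset.mem_Icc]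
      split_ifs <;> omega⟩

@[simp] theorem unshift_shift (e i : SignedIndex n) : unshift e (shift i) = i := by
  have h := i.bounds
  have h' : ¬ ((shift i : ℤ) = 1 ∨ (shift i : ℤ) = -1) := by
    rw [coe_shift]
    split_ifs <;> omega
  rw [unshift, dif_neg h']
  apply Subtype.ext
  simp only [coe_shift]
  split_ifs <;> omega

@[simp] theorem unshift_first (e : SignedIndex n) : unshift e (first n) = e :=
  dif_pos (Or.inl rfl)

@[simp] theorem unshift_neg_first (e : SignedIndex n) : unshift e (-first n) = e :=
  dif_pos (Or.inr rfl)

theorem eq_shift_of_ne {x : SignedIndex (n + 1)} (h₁ : x ≠ first n) (h₂ : x ≠ -first n) :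
    ∃ i, x = shift i := by
  have h := x.bounds
  push_cast at h
  have h₁' : (x : ℤ) ≠ 1 := fun h => h₁ (Subtype.ext h)
  have h₂' : (x : ℤ) ≠ -1 := fun h => h₂ (Subtype.ext h)
  refine ⟨⟨if 0 < (x : ℤ) then x - 1 else x + 1, ?_⟩, Subtype.ext ?_⟩
  · rw [Finset.mem_erase, Finset.mem_Icc]
    split_ifs <;> omega
  · simp only [coe_shift]
    split_ifs <;> omega

theorem cases_shift (x : SignedIndex (n + 1)) :
    x = first n ∨ x = -first n ∨ ∃ i, x = shift i := by
  by_cases h₁ : x = first n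
  · exact Or.inl h₁
  by_cases h₂ : x = -first n
  · exact Or.inr (Or.inl h₂)
  exact Or.inr (Or.inr (eq_shift_of_ne h₁ h₂))

/-- `shift`, as an equivalence onto its range `⟦n + 1⟧ \ {±1}`. -/
noncomputable def shiftEquiv (n : ℕ) :
    SignedIndex n ≃ {x : SignedIndex (n + 1) // x ≠ first n ∧ x ≠ -first n} :=
  Equiv.ofBijective (fun i => ⟨shift i, shift_ne_first i, shift_ne_neg_first i⟩)
    ⟨fun _ _ h => shift_injective (congrArg Subtype.val h), fun x => by
      obtain ⟨i, hi⟩ := eq_shift_of_ne x.2.1 x.2.2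
      exact ⟨i, Subtype.ext hi.symm⟩⟩

@[simp] theorem coe_shiftEquiv (i : SignedIndex n) :
    (shiftEquiv n i : SignedIndex (n + 1)) = shift i := rfl

end SignedIndex

namespace SignedPerm

open SignedIndex Equiv

variable {n : ℕ}

/-! ### Extension and insertion -/

@[simp] theorem map_neg (π : SignedPerm n) (i : SignedIndex n) : π.1 (-i) = -π.1 i := π.2 i

theorem symm_neg (π : SignedPerm n) (i : SignedIndex n) : π.1.symm (-i) = -π.1.symm i := by
  rw [Equiv.symm_apply_eq, map_neg, Equiv.apply_symm_apply]

/-- The product of the transpositions `(a b)` and `(-a -b)`, as a signed permutation. -/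
def signedSwap (a b : SignedIndex n) (h : a ≠ -b) : SignedPerm n :=
  ⟨swap a b * swap (-a) (-b), by
    have hn (c d x : SignedIndex n) : swap c d (-x) = -swap (-c) (-d) x := by
      have := (neg_injective (G := SignedIndex n)).swap_apply (-c) (-d) x
      simpa using this
    have hc : swap a b * swap (-a) (-b) = swap (-a) (-b) * swap a b := by
      ext x
      simp only [Perm.mul_apply, swap_apply_def]
      have := neg_ne_self a
      have := neg_ne_self b
      have : b ≠ -a := fun hb => h (by rw [hb, neg_neg])
      grind
    intro x
    rw [Perm.mul_apply, hn, hn, neg_neg, neg_neg, ← Perm.mul_apply, ← hc]⟩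

/-- The extension of `π` to a signed permutation of size `n + 1`: transport along `shift`,
and `1 ↦ -1`. -/
noncomputable def extend (π : SignedPerm n) : SignedPerm (n + 1) :=
  ⟨π.1.extendDomain (shiftEquiv n) * swap (first n) (-first n), by
    have h₁ : π.1.extendDomain (shiftEquiv n) (first n) = first n :=
      Perm.extendDomain_apply_not_subtype _ _ (by simp)
    have h₂ : π.1.extendDomain (shiftEquiv n) (-first n) = -first n :=
      Perm.extendDomain_apply_not_subtype _ _ (by simp)
    intro x
    obtain rfl | rfl | ⟨i, rfl⟩ := cases_shift x
    · simp [h₁, h₂]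
    · simp [h₁, h₂]
    · rw [← shift_neg, Perm.mul_apply, Perm.mul_apply,
        swap_apply_of_ne_of_ne (shift_ne_first _) (shift_ne_neg_first _),
        swap_apply_of_ne_of_ne (shift_ne_first _) (shift_ne_neg_first _)]
      have h (j) := π.1.extendDomain_apply_image (shiftEquiv n) j
      simp only [coe_shiftEquiv] at h
      rw [h, h, map_neg, shift_neg]⟩

@[simp] theorem extend_shift (π : SignedPerm n) (i : SignedIndex n) :
    π.extend.1 (shift i) = shift (π.1 i) := by
  have h := π.1.extendDomain_apply_image (shiftEquiv n) i
  simp only [coe_shiftEquiv] at h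
  simp only [extend, Perm.mul_apply]
  rw [swap_apply_of_ne_of_ne (shift_ne_first _) (shift_ne_neg_first _), h]

@[simp] theorem extend_first (π : SignedPerm n) : π.extend.1 (first n) = -first n := by
  simp only [extend, Perm.mul_apply, swap_apply_left]
  exact Perm.extendDomain_apply_not_subtype _ _ (by simp)

theorem ext_shift {σ τ : SignedPerm (n + 1)} (h₁ : σ.1 (first n) = τ.1 (first n))
    (h : ∀ i, σ.1 (shift i) = τ.1 (shift i)) : σ = τ := by
  refine Subtype.ext (Equiv.ext fun x => ?_)
  obtain rfl | rfl | ⟨i, rfl⟩ := cases_shift x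
  · exact h₁
  · rw [map_neg, map_neg, h₁]
  · exact h i

theorem extend_injective : Function.Injective (extend (n := n)) := fun π ρ h => by
  refine Subtype.ext (Equiv.ext fun i => ?_)
  rw [← shift_inj, ← extend_shift, ← extend_shift, h]

theorem exists_extend_eq {σ : SignedPerm (n + 1)} (h : σ.1 (first n) = -first n) :
    ∃ π : SignedPerm n, π.extend = σ := by
  have h' : σ.1 (-first n) = first n := by rw [map_neg, h, neg_neg]
  have hs (i : SignedIndex n) : ∃ j, σ.1 (shift i) = shift j := by
    refine eq_shift_of_ne (fun hi => ?_) fun hi => ?_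
    · exact shift_ne_neg_first i (σ.1.injective (hi.trans h'.symm))
    · exact shift_ne_first i (σ.1.injective (hi.trans h.symm))
  choose f hf using hs
  have hinj : Function.Injective f := fun i j hij =>
    shift_injective (σ.1.injective (by rw [hf, hf, hij]))
  let π : SignedPerm n := ⟨Equiv.ofBijective f (Finite.injective_iff_bijective.1 hinj), fun i => by
    rw [Equiv.ofBijective_apply, Equiv.ofBijective_apply, ← shift_inj, ← hf, shift_neg, map_neg,
      hf, shift_neg]⟩
  exact ⟨π, ext_shift (by rw [extend_first, h]) fun i => by rw [extend_shift, hf]; rfl⟩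

/-- The signed permutation of size `n + 1` obtained by shifting `π` and replacing the arcs
`e → π e` and `-e → -π e` by the paths `e → 1 → -π e` and `-e → -1 → π e`. -/
noncomputable def insert (π : SignedPerm n) (e : SignedIndex n) : SignedPerm (n + 1) :=
  ⟨π.extend.1 * (signedSwap (shift e) (-first n) (by simp)).1, fun i => by
    simp only [Perm.mul_apply, map_neg]⟩

theorem signedSwap_shift (e : SignedIndex n) :
    (signedSwap (shift e) (-first n) (by simp)).1 (shift e) = -first n := by
  have := neg_ne_self (shift e)
  simp [signedSwap, swap_apply_of_ne_of_ne this.symm]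

theorem signedSwap_first (e : SignedIndex n) :
    (signedSwap (shift e) (-first n) (by simp)).1 (first n) = -shift e := by
  have h := neg_ne_self (shift e)
  have : -shift e ≠ -first n := by simp
  simp [signedSwap, swap_apply_of_ne_of_ne h this]

theorem signedSwap_of_ne {e i : SignedIndex n} (h : i ≠ e) (h' : i ≠ -e) :
    (signedSwap (shift e) (-first n) (by simp)).1 (shift i) = shift i := by
  have h₁ : shift i ≠ -shift e := by rwa [← shift_neg, Ne, shift_inj]
  have h₂ : shift i ≠ shift e := by rwa [Ne, shift_inj]
  simp [signedSwap, swap_apply_of_ne_of_ne h₁ (shift_ne_first i),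
    swap_apply_of_ne_of_ne h₂ (shift_ne_neg_first i)]

@[simp] theorem insert_shift_self (π : SignedPerm n) (e : SignedIndex n) :
    (π.insert e).1 (shift e) = first n := by
  simp [insert, signedSwap_shift]

@[simp] theorem insert_first (π : SignedPerm n) (e : SignedIndex n) :
    (π.insert e).1 (first n) = -shift (π.1 e) := by
  simp [insert, signedSwap_first]

theorem insert_shift_of_ne (π : SignedPerm n) {e i : SignedIndex n} (h : i ≠ e) (h' : i ≠ -e) :
    (π.insert e).1 (shift i) = shift (π.1 i) := by
  simp [insert, signedSwap_of_ne h h']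

/-- The insertion of `1` determines the permutation and the place of insertion. -/
theorem insert_injective {π ρ : SignedPerm n} {e f : SignedIndex n}
    (h : π.insert e = ρ.insert f) : π = ρ ∧ e = f := by
  have hef : e = f := by
    rw [← shift_inj]
    apply (π.insert e).1.injective
    rw [insert_shift_self, h, insert_shift_self]
  subst hef
  refine ⟨extend_injective (Subtype.ext ?_), rfl⟩
  exact mul_right_cancel (congrArg Subtype.val h)

theorem exists_insert_eq {σ : SignedPerm (n + 1)} {e : SignedIndex n}
    (h : σ.1 (shift e) = first n) : ∃ π : SignedPerm n, π.insert e = σ := by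
  let s := signedSwap (shift e) (-first n) (by simp)
  let τ : SignedPerm (n + 1) := ⟨σ.1 * s.1⁻¹, fun i => by
    rw [Perm.mul_apply, Perm.mul_apply, Perm.inv_def, symm_neg, map_neg]⟩
  have hτ : τ.1 (first n) = -first n := by
    have : s.1⁻¹ (first n) = -shift e := by
      rw [Perm.inv_eq_iff_eq, map_neg, signedSwap_shift, neg_neg]
    simp only [τ, Perm.mul_apply, this, map_neg, h]
  obtain ⟨π, hπ⟩ := exists_extend_eq hτ
  refine ⟨π, Subtype.ext ?_⟩
  simp only [insert, hπ, τ]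
  exact inv_mul_cancel_right _ _

/-! ### Alternation -/

theorem cycleAlternating_iff (π : SignedPerm n) :
    π.CycleAlternating ↔ ∀ i, π.1 i ≠ i ∧ (π.1 i < i ↔ ¬ π.1 (π.1 i) < π.1 i) := by
  constructor
  · intro h i
    have h₀ := h i
    have h₁ := h (π.1 i)
    simp only [IsCyclePeak, IsCycleValley, Equiv.symm_apply_apply] at h₀ h₁
    grind
  · intro h i
    have h₀ := h i
    have h₁ := h (π.1.symm i)
    simp only [IsCyclePeak, IsCycleValley, Equiv.apply_symm_apply] at h₀ h₁ ⊢
    grind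

theorem map_neg_lt_neg_iff (π : SignedPerm n) (i : SignedIndex n) :
    π.1 (-i) < -i ↔ i < π.1 i := by
  rw [map_neg, neg_lt_neg]

theorem cycleAlternating_extend (π : SignedPerm n) :
    π.extend.CycleAlternating ↔ π.CycleAlternating := by
  rw [cycleAlternating_iff, cycleAlternating_iff]
  constructor
  · intro h i
    have := h (shift i)
    simpa using this
  · intro h x
    have h₁ : -first n < first n := by
      rw [← Subtype.coe_lt_coe, coe_neg, coe_first]
      norm_num
    have h₂ := h₁.ne
    have h₃ := h₁.not_gt
    obtain rfl | rfl | ⟨i, rfl⟩ := cases_shift x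
    · simp [h₁, h₂, h₃]
    · simp [h₁, h₂.symm, h₃]
    · simpa using h i

/-- The places where `1` can be inserted into an alternating permutation: the indices
whose image has the opposite sign. -/
noncomputable def signChanges (π : SignedPerm n) : Finset (SignedIndex n) :=
  Finset.univ.filter fun e => (0 < (e : ℤ) ↔ (π.1 e : ℤ) < 0)

theorem mem_signChanges {π : SignedPerm n} {e : SignedIndex n} :
    e ∈ π.signChanges ↔ (0 < (e : ℤ) ↔ (π.1 e : ℤ) < 0) := by
  simp [signChanges]

theorem insert_neg_shift (π : SignedPerm n) (e : SignedIndex n) :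
    (π.insert e).1 (shift (-e)) = -first n := by
  rw [shift_neg, map_neg, insert_shift_self]

theorem map_lt_iff_of_mem_signChanges {π : SignedPerm n} {e : SignedIndex n}
    (he : e ∈ π.signChanges) : π.1 e < e ↔ 0 < (e : ℤ) := by
  rw [mem_signChanges] at he
  rw [← Subtype.coe_lt_coe]
  have := (π.1 e).bounds
  have := e.bounds
  omega

theorem map_ne_of_mem_signChanges {π : SignedPerm n} {e : SignedIndex n}
    (he : e ∈ π.signChanges) : π.1 e ≠ e := by
  rw [mem_signChanges] at he
  intro h
  rw [h] at he
  have := e.bounds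
  omega

theorem neg_mem_signChanges {π : SignedPerm n} {e : SignedIndex n}
    (he : e ∈ π.signChanges) : -e ∈ π.signChanges := by
  rw [mem_signChanges] at he ⊢
  rw [map_neg, coe_neg, coe_neg]
  have := (π.1 e).bounds
  have := e.bounds
  omega

/-- At every shifted index the insertion of `1` preserves the direction of the step. -/
theorem insert_shift_lt_iff {π : SignedPerm n} {e : SignedIndex n}
    (he : e ∈ π.signChanges) (i : SignedIndex n) :
    (π.insert e).1 (shift i) < shift i ↔ π.1 i < i := by
  by_cases h : i = e
  · subst h
    rw [insert_shift_self, first_lt_shift, map_lt_iff_of_mem_signChanges he]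
  by_cases h' : i = -e
  · subst h'
    rw [map_lt_iff_of_mem_signChanges (neg_mem_signChanges he), insert_neg_shift, shift_neg,
      neg_lt_neg, shift_lt_first, coe_neg]
    omega
  rw [insert_shift_of_ne π h h', shift_lt_shift]

theorem insert_shift_ne {π : SignedPerm n} {e : SignedIndex n}
    (he : e ∈ π.signChanges) (i : SignedIndex n) :
    (π.insert e).1 (shift i) ≠ shift i ↔ π.1 i ≠ i := by
  by_cases h : i = e
  · subst h
    simp [map_ne_of_mem_signChanges he, (shift_ne_first _).symm]
  by_cases h' : i = -e
  · subst h'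
    simp only [insert_neg_shift, map_ne_of_mem_signChanges (neg_mem_signChanges he), ne_eq,
      (shift_ne_neg_first _).symm, not_false_eq_true]
  rw [insert_shift_of_ne π h h', Ne, shift_inj]

theorem map_neg_lt_iff {π : SignedPerm n} {i : SignedIndex n} (h : π.1 i ≠ i) :
    π.1 (-i) < -i ↔ ¬ π.1 i < i := by
  rw [map_neg_lt_neg_iff, not_lt, le_iff_lt_or_eq, or_iff_left h.symm]

theorem insert_first_lt_iff {π : SignedPerm n} {e : SignedIndex n}
    (he : e ∈ π.signChanges) : (π.insert e).1 (first n) < first n ↔ (e : ℤ) < 0 := by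
  rw [mem_signChanges] at he
  rw [insert_first, ← shift_neg, shift_lt_first, coe_neg]
  have := (π.1 e).bounds
  have := e.bounds
  omega

theorem insert_first_ne (π : SignedPerm n) (e : SignedIndex n) :
    (π.insert e).1 (first n) ≠ first n := by
  rw [insert_first, ← shift_neg]
  exact shift_ne_first _

theorem insert_first_ne_neg (π : SignedPerm n) (e : SignedIndex n) :
    (π.insert e).1 (first n) ≠ -first n := by
  rw [insert_first, ← shift_neg]
  exact shift_ne_neg_first _

/-- The alternation condition at `-i` is equivalent to the one at `i`. -/
theorem alternating_neg_iff {π : SignedPerm n} {i : SignedIndex n}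
    (h : π.1 i ≠ i) (h' : π.1 (π.1 i) ≠ π.1 i) :
    (π.1 (-i) < -i ↔ ¬ π.1 (π.1 (-i)) < π.1 (-i)) ↔ (π.1 i < i ↔ ¬ π.1 (π.1 i) < π.1 i) := by
  rw [map_neg_lt_iff h, map_neg π i, map_neg_lt_iff h']
  tauto

theorem cycleAlternating_insert {π : SignedPerm n} {e : SignedIndex n}
    (he : e ∈ π.signChanges) : (π.insert e).CycleAlternating ↔ π.CycleAlternating := by
  rw [cycleAlternating_iff, cycleAlternating_iff]
  -- fixed points are excluded first: without them, negation reverses the direction of a step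
  have hf : (∀ x, (π.insert e).1 x ≠ x) ↔ ∀ i, π.1 i ≠ i := by
    refine ⟨fun h i => (insert_shift_ne he i).1 (h _), fun h x => ?_⟩
    obtain rfl | rfl | ⟨i, rfl⟩ := cases_shift x
    · exact insert_first_ne π e
    · rw [map_neg]
      exact fun h => insert_first_ne π e (neg_injective h)
    · exact (insert_shift_ne he i).2 (h i)
  rw [forall_and, forall_and, hf]
  refine and_congr_right fun hfix => ?_
  have hfix' := hf.2 hfix
  have hs := map_lt_iff_of_mem_signChanges he
  have hp := e.pos_or_neg
  -- the two steps `e → 1` and `1 → -π e` always have opposite directions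
  have h_e : (π.insert e).1 (shift e) < shift e ↔
      ¬ (π.insert e).1 ((π.insert e).1 (shift e)) < (π.insert e).1 (shift e) := by
    rw [insert_shift_lt_iff he, insert_shift_self, insert_first_lt_iff he, hs]
    rcases hp with ⟨h₁, h₂⟩ | ⟨h₁, h₂⟩ <;> simp [h₁, h₂]
  -- the condition at `1` for the new permutation is the condition at `e` for the old one
  have h_first : ((π.insert e).1 (first n) < first n ↔
      ¬ (π.insert e).1 ((π.insert e).1 (first n)) < (π.insert e).1 (first n)) ↔
        (π.1 e < e ↔ ¬ π.1 (π.1 e) < π.1 e) := by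
    rw [insert_first_lt_iff he, insert_first, ← shift_neg, insert_shift_lt_iff he,
      map_neg_lt_iff (hfix _), hs]
    rcases hp with ⟨h₁, h₂⟩ | ⟨h₁, h₂⟩ <;> simp [h₁, h₂]
  have h_ne {i} (h : i ≠ e) (h' : i ≠ -e) : ((π.insert e).1 (shift i) < shift i ↔
      ¬ (π.insert e).1 ((π.insert e).1 (shift i)) < (π.insert e).1 (shift i)) ↔
        (π.1 i < i ↔ ¬ π.1 (π.1 i) < π.1 i) := by
    rw [insert_shift_lt_iff he, insert_shift_of_ne π h h', insert_shift_lt_iff he]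
  constructor
  · intro H i
    by_cases h : i = e
    · subst h
      exact h_first.1 (H _)
    by_cases h' : i = -e
    · subst h'
      exact (alternating_neg_iff (hfix _) (hfix _)).2 (h_first.1 (H _))
    exact (h_ne h h').1 (H _)
  · intro H x
    obtain rfl | rfl | ⟨i, rfl⟩ := cases_shift x
    · exact h_first.2 (H _)
    · exact (alternating_neg_iff (hfix' _) (hfix' _)).2 (h_first.2 (H _))
    by_cases h : i = e
    · subst h
      exact h_e
    by_cases h' : i = -e
    · subst h'
      rw [shift_neg]
      exact (alternating_neg_iff (hfix' _) (hfix' _)).2 h_e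
    exact (h_ne h h').2 (H _)

/-- An alternating permutation that does not exchange `1` and `-1` arises by inserting `1`:
its neighbours have the same sign because both of them lie on the same side of `1`. -/
theorem CycleAlternating.exists_insert_eq {σ : SignedPerm (n + 1)} (hσ : σ.CycleAlternating)
    (h : σ.1 (first n) ≠ -first n) :
    ∃ (π : SignedPerm n) (e : SignedIndex n), e ∈ π.signChanges ∧ π.insert e = σ := by
  have hfix := fun x => (((cycleAlternating_iff σ).1 hσ) x).1
  obtain ⟨e, he⟩ : ∃ e, σ.1.symm (first n) = shift e := by
    refine eq_shift_of_ne (fun h' => ?_) fun h' => ?_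
    · rw [Equiv.symm_apply_eq] at h'
      exact hfix _ h'.symm
    · rw [Equiv.symm_apply_eq, map_neg] at h'
      exact h (by rw [← neg_neg (σ.1 (first n)), ← h'])
  obtain ⟨π, rfl⟩ := SignedPerm.exists_insert_eq (σ := σ) (e := e)
    ((Equiv.symm_apply_eq _).1 he).symm
  refine ⟨π, e, ?_, rfl⟩
  have := hσ (first n)
  rw [IsCyclePeak, IsCycleValley, he, insert_first, ← shift_neg, shift_lt_first, shift_lt_first,
    first_lt_shift, first_lt_shift, coe_neg] at this
  rw [mem_signChanges]
  omega

/-! ### The number of negative entries -/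

/-- The positive indices with negative image. -/
noncomputable def negIndices (π : SignedPerm n) : Finset (SignedIndex n) :=
  Finset.univ.filter fun i => 0 < (i : ℤ) ∧ (π.1 i : ℤ) < 0

theorem mem_negIndices {π : SignedPerm n} {i : SignedIndex n} :
    i ∈ π.negIndices ↔ 0 < (i : ℤ) ∧ (π.1 i : ℤ) < 0 := by
  simp [negIndices]

theorem card_negIndices (π : SignedPerm n) : π.negIndices.card = π.negCount := rfl

theorem neg_mem_negIndices {π : SignedPerm n} {i : SignedIndex n} :
    -i ∈ π.negIndices ↔ (i : ℤ) < 0 ∧ 0 < (π.1 i : ℤ) := by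
  simp [mem_negIndices]

/-- The sign changes are the positive indices with negative image and their negatives. -/
theorem sum_signChanges {M : Type*} [AddCommMonoid M] (π : SignedPerm n) (f : SignedIndex n → M) :
    ∑ e ∈ π.signChanges, f e = ∑ e ∈ π.negIndices, (f e + f (-e)) := by
  have h : π.signChanges = π.negIndices ∪ π.negIndices.map ⟨(-·), neg_injective⟩ := by
    ext e
    have h₁ := (π.1 e).bounds
    have h₂ := e.bounds
    have h₃ : e ∈ π.negIndices.map ⟨(-·), neg_injective⟩ ↔ -e ∈ π.negIndices := by
      rw [← Finset.mem_map' ⟨(-·), neg_injective⟩ (a := -e)]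
      simp
    rw [Finset.mem_union, h₃, neg_mem_negIndices, mem_negIndices, mem_signChanges]
    omega
  have hd : Disjoint π.negIndices (π.negIndices.map ⟨(-·), neg_injective⟩) := by
    rw [Finset.disjoint_left]
    intro e he he'
    obtain ⟨i, hi, rfl⟩ := Finset.mem_map.1 he'
    have h₁ := (mem_negIndices.1 hi).1
    have h₂ := (mem_negIndices.1 he).1
    simp only [Function.Embedding.coeFn_mk, coe_neg] at h₂
    omega
  rw [h, Finset.sum_union hd, Finset.sum_map, Finset.sum_add_distrib]
  rfl

theorem negCount_extend (π : SignedPerm n) : π.extend.negCount = π.negCount + 1 := by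
  have h : π.extend.negIndices = Insert.insert (first n) (π.negIndices.image shift) := by
    ext x
    obtain rfl | rfl | ⟨i, rfl⟩ := cases_shift x <;>
      simp [mem_negIndices, neg_ne_self]
  rw [← card_negIndices, h, Finset.card_insert_of_notMem (by simp),
    Finset.card_image_of_injective _ shift_injective, card_negIndices]

theorem negCount_insert_of_mem {π : SignedPerm n} {e : SignedIndex n} (he : e ∈ π.negIndices) :
    (π.insert e).negCount = π.negCount - 1 := by
  have h : (π.insert e).negIndices = (π.negIndices.erase e).image shift := by
    have he' := mem_negIndices.1 he
    ext x
    obtain rfl | rfl | ⟨i, rfl⟩ := cases_shift x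
    · simp [mem_negIndices, he'.2.le]
    · simp [mem_negIndices]
    rw [shift_injective.mem_finset_image, Finset.mem_erase, mem_negIndices, mem_negIndices,
      coe_shift_pos]
    by_cases h : i = e
    · subst h
      simp
    by_cases h' : i = -e
    · subst h'
      simp [he'.1.not_gt]
    simp [insert_shift_of_ne π h h', h]
  rw [← card_negIndices, h, Finset.card_image_of_injective _ shift_injective,
    Finset.card_erase_of_mem he, card_negIndices]

theorem negCount_insert_neg_of_mem {π : SignedPerm n} {e : SignedIndex n}
    (he : e ∈ π.negIndices) : (π.insert (-e)).negCount = π.negCount + 1 := by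
  have h : (π.insert (-e)).negIndices = Insert.insert (first n) (π.negIndices.image shift) := by
    have he' := mem_negIndices.1 he
    ext x
    obtain rfl | rfl | ⟨i, rfl⟩ := cases_shift x
    · simp [mem_negIndices, he'.2]
    · simp [mem_negIndices, neg_ne_self]
    rw [Finset.mem_insert, shift_injective.mem_finset_image, mem_negIndices, mem_negIndices,
      coe_shift_pos]
    by_cases h : i = e
    · subst h
      have := insert_neg_shift π (-i)
      rw [neg_neg] at this
      simp [this, he']
    by_cases h' : i = -e
    · subst h'
      simp [he'.1.not_gt, neg_eq_iff_eq_neg]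
    simp [insert_shift_of_ne π h' (by simpa using h)]
  rw [← card_negIndices, h, Finset.card_insert_of_notMem (by simp),
    Finset.card_image_of_injective _ shift_injective, card_negIndices]

/-! ### One-cycle permutations -/

/-- There is no proper non-empty set of indices that is stable under `π` and under negation.
For positive size this says that `π` has exactly one cycle. -/
def Indecomposable (π : SignedPerm n) : Prop :=
  ∀ S : SignedIndex n → Prop, (∀ i, S (-i) ↔ S i) → (∀ i, S (π.1 i) ↔ S i) → ∀ i j, S i → S j

/-- The negative of the orbit of `x` is the orbit of `-x`. -/
theorem image_neg_orbit (π : SignedPerm n) (x : SignedIndex n) :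
    (fun y => -y) '' {y | π.1.SameCycle x y} = {y | π.1.SameCycle (-x) y} := by
  have hpow (m : ℕ) (z : SignedIndex n) : (π.1 ^ m) (-z) = -(π.1 ^ m) z := by
    induction m with
    | zero => rfl
    | succ m ih => rw [pow_succ', Perm.mul_apply, Perm.mul_apply, ih, map_neg]
  have h {x y : SignedIndex n} (h : π.1.SameCycle x y) : π.1.SameCycle (-x) (-y) := by
    obtain ⟨m, rfl⟩ := h.exists_nat_pow_eq
    exact ⟨m, by rw [zpow_natCast, hpow]⟩
  ext y
  constructor
  · rintro ⟨z, hz, rfl⟩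
    exact h hz
  · intro hy
    exact ⟨-y, by simpa using h hy, neg_neg y⟩

theorem mem_cycles_iff (π : SignedPerm n) (c : Sym2 (Set (SignedIndex n))) :
    c ∈ π.cycles ↔
      ∃ x, c = s({y | π.1.SameCycle x y}, {y | π.1.SameCycle (-x) y}) := by
  constructor
  · rintro ⟨_, ⟨x, rfl⟩, _, -, h, rfl⟩
    exact ⟨x, by rw [← h, image_neg_orbit]⟩
  · rintro ⟨x, rfl⟩
    exact ⟨_, ⟨x, rfl⟩, _, ⟨-x, rfl⟩, image_neg_orbit π x, rfl⟩

theorem existsUnique_mem_cycles_iff (π : SignedPerm (n + 1)) :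
    (∃! c, c ∈ π.cycles) ↔ π.Indecomposable := by
  constructor
  · intro h S hneg hπ i j hi
    have hS {x y} (hx : S x) (hxy : π.1.SameCycle x y) : S y := by
      obtain ⟨m, rfl⟩ := hxy.exists_nat_pow_eq
      induction m with
      | zero => exact hx
      | succ m ih =>
        rw [pow_succ', Perm.mul_apply, hπ]
        exact ih ⟨m, rfl⟩
    have hij := h.unique ((mem_cycles_iff π _).2 ⟨i, rfl⟩) ((mem_cycles_iff π _).2 ⟨j, rfl⟩)
    have hj : j ∈ {y | π.1.SameCycle i y} ∨ j ∈ {y | π.1.SameCycle (-i) y} := by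
      have hjj : j ∈ {y | π.1.SameCycle j y} := Perm.SameCycle.refl _ _
      rcases Sym2.eq_iff.1 hij with ⟨h, -⟩ | ⟨-, h⟩
      · exact Or.inl (h ▸ hjj)
      · exact Or.inr (h ▸ hjj)
    rcases hj with hj | hj
    · exact hS hi hj
    · exact hS ((hneg i).2 hi) hj
  · intro h
    refine ⟨_, (mem_cycles_iff π _).2 ⟨first n, rfl⟩, fun c hc => ?_⟩
    obtain ⟨x, rfl⟩ := (mem_cycles_iff π _).1 hc
    have hset {x y} (hxy : π.1.SameCycle x y) :
        {z | π.1.SameCycle x z} = {z | π.1.SameCycle y z} :=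
      Set.ext fun z => ⟨hxy.symm.trans, hxy.trans⟩
    -- the union of the two orbits of `1` and `-1` is stable
    refine h (fun x => s({y | π.1.SameCycle x y}, {y | π.1.SameCycle (-x) y}) =
      s({y | π.1.SameCycle (first n) y}, {y | π.1.SameCycle (-first n) y})) (fun i => ?_)
      (fun i => ?_) (first n) x rfl
    · rw [neg_neg, Sym2.eq_swap]
    · rw [← map_neg, ← hset (x := i) (y := π.1 i) ⟨1, rfl⟩,
        ← hset (x := -i) (y := π.1 (-i)) ⟨1, rfl⟩]

/-- Stable sets of `π` and of `π.insert e` correspond: `±1` belong to the part of `e`. -/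
theorem indecomposable_insert (π : SignedPerm n) (e : SignedIndex n) :
    (π.insert e).Indecomposable ↔ π.Indecomposable := by
  constructor
  · intro h S hneg hπ i j hi
    have H := h (fun x => S (unshift e x)) (fun x => ?_) (fun x => ?_) (shift i) (shift j)
    · simpa using H (by simpa using hi)
    · obtain rfl | rfl | ⟨i, rfl⟩ := cases_shift x
      · simp
      · simp
      · rw [← shift_neg, unshift_shift, unshift_shift, hneg]
    · have hfirst : S (unshift e ((π.insert e).1 (first n))) ↔ S e := by
        rw [insert_first, ← shift_neg, unshift_shift, hneg, hπ]
      have hfirst' : S (unshift e ((π.insert e).1 (-first n))) ↔ S e := by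
        rw [map_neg, insert_first, neg_neg, unshift_shift, hπ]
      obtain rfl | rfl | ⟨i, rfl⟩ := cases_shift x
      · simpa using hfirst
      · simpa using hfirst'
      by_cases h : i = e
      · subst h
        simp
      by_cases h' : i = -e
      · subst h'
        rw [insert_neg_shift, unshift_neg_first, unshift_shift, hneg]
      rw [insert_shift_of_ne π h h', unshift_shift, unshift_shift, hπ]
  · intro h S hneg hπ i j hi
    have hfirst : S (first n) ↔ S (shift e) := by rw [← hπ (shift e), insert_shift_self]
    have hshift (x) : ∃ i, S x ↔ S (shift i) := by
      obtain rfl | rfl | ⟨i, rfl⟩ := cases_shift x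
      · exact ⟨e, hfirst⟩
      · exact ⟨e, by rw [hneg, hfirst]⟩
      · exact ⟨i, Iff.rfl⟩
    have he : S (shift (π.1 e)) ↔ S (shift e) := by
      rw [← hneg, ← insert_first, hπ, hfirst]
    obtain ⟨i', hi'⟩ := hshift i
    obtain ⟨j', hj'⟩ := hshift j
    rw [hj']
    refine h (fun i => S (shift i)) (fun i => by rw [shift_neg, hneg]) (fun i => ?_) i' j'
      (hi'.1 hi)
    by_cases h : i = e
    · rw [h, he]
    by_cases h' : i = -e
    · rw [h', map_neg, shift_neg, shift_neg, hneg, hneg, he]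
    rw [← insert_shift_of_ne π h h', hπ]

theorem not_indecomposable_extend (π : SignedPerm (n + 1)) : ¬ π.extend.Indecomposable := by
  intro h
  have := h (fun x => x = first (n + 1) ∨ x = -first (n + 1)) (fun i => ?_) (fun i => ?_)
    (first (n + 1)) (shift (first n)) (Or.inl rfl)
  · simp at this
  · rw [neg_inj, or_comm, neg_eq_iff_eq_neg]
  · obtain rfl | rfl | ⟨i, rfl⟩ := cases_shift i <;> simp

/-! ### Recurrences for the generating functions -/

theorem mem_cycleAlternatingPerms {π : SignedPerm n} :
    π ∈ cycleAlternatingPerms n ↔ π.CycleAlternating := by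
  simp [cycleAlternatingPerms]

theorem mem_oneCycleAlternatingPerms {π : SignedPerm (n + 1)} :
    π ∈ oneCycleAlternatingPerms (n + 1) ↔ π.CycleAlternating ∧ π.Indecomposable := by
  classical
  rw [oneCycleAlternatingPerms, Finset.mem_filter, mem_cycleAlternatingPerms,
    existsUnique_mem_cycles_iff]

/-- Reindexing of a sum along the insertion of `1`. -/
theorem sum_eq_sum_insert {M : Type*} [AddCommMonoid M] {A : Finset (SignedPerm n)}
    {B : Finset (SignedPerm (n + 1))} {T : SignedPerm n → Finset (SignedIndex n)}
    (h : ∀ σ, σ ∈ B ↔ ∃ π ∈ A, ∃ e ∈ T π, π.insert e = σ) (f : SignedPerm (n + 1) → M) :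
    ∑ σ ∈ B, f σ = ∑ π ∈ A, ∑ e ∈ T π, f (π.insert e) := by
  rw [Finset.sum_sigma']
  refine (Finset.sum_bij (fun x _ => x.1.insert x.2) (fun x hx => ?_) (fun x _ y _ hxy => ?_)
    (fun σ hσ => ?_) fun _ _ => rfl).symm
  · rw [Finset.mem_sigma] at hx
    exact (h _).2 ⟨x.1, hx.1, x.2, hx.2, rfl⟩
  · obtain ⟨h₁, h₂⟩ := insert_injective hxy
    exact Sigma.ext h₁ (heq_of_eq h₂)
  · obtain ⟨π, hπ, e, he, rfl⟩ := (h σ).1 hσ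
    exact ⟨⟨π, e⟩, Finset.mem_sigma.2 ⟨hπ, he⟩, rfl⟩

/-- Insertion at a positive sign change lowers `neg` by one. -/
theorem sum_negIndices_X_pow (π : SignedPerm n) :
    ∑ e ∈ π.negIndices, (X : ℝ[X]) ^ (π.insert e).negCount =
      derivative ((X : ℝ[X]) ^ π.negCount) := by
  rw [Finset.sum_congr rfl fun e he => by rw [negCount_insert_of_mem he], Finset.sum_const,
    card_negIndices, nsmul_eq_mul, derivative_X_pow]
  simp

theorem sum_signChanges_X_pow (π : SignedPerm n) :
    ∑ e ∈ π.signChanges, (X : ℝ[X]) ^ (π.insert e).negCount =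
      (1 + X ^ 2) * derivative ((X : ℝ[X]) ^ π.negCount) := by
  rw [sum_signChanges, Finset.sum_add_distrib, sum_negIndices_X_pow, add_mul, one_mul]
  congr 1
  rw [← sum_negIndices_X_pow, Finset.mul_sum]
  refine Finset.sum_congr rfl fun e he => ?_
  have h : 0 < π.negCount := by
    rw [← card_negIndices]
    exact Finset.card_pos.2 ⟨e, he⟩
  rw [negCount_insert_neg_of_mem he, negCount_insert_of_mem he, ← pow_add]
  congr 1
  omega

theorem mem_oneCycleAlternatingPerms_succ (σ : SignedPerm (n + 2)) :
    σ ∈ oneCycleAlternatingPerms (n + 2) ↔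
      ∃ π ∈ oneCycleAlternatingPerms (n + 1), ∃ e ∈ π.signChanges, π.insert e = σ := by
  rw [mem_oneCycleAlternatingPerms]
  constructor
  · rintro ⟨hσ, hone⟩
    have h : σ.1 (first (n + 1)) ≠ -first (n + 1) := fun h => by
      obtain ⟨π, rfl⟩ := exists_extend_eq h
      exact not_indecomposable_extend π hone
    obtain ⟨π, e, he, rfl⟩ := hσ.exists_insert_eq h
    exact ⟨π, mem_oneCycleAlternatingPerms.2
      ⟨(cycleAlternating_insert he).1 hσ, (indecomposable_insert π e).1 hone⟩, e, he, rfl⟩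
  · rintro ⟨π, hπ, e, he, rfl⟩
    obtain ⟨h₁, h₂⟩ := mem_oneCycleAlternatingPerms.1 hπ
    exact ⟨(cycleAlternating_insert he).2 h₁, (indecomposable_insert π e).2 h₂⟩

theorem sum_oneCycleAlternatingPerms_succ (n : ℕ) :
    ∑ σ ∈ oneCycleAlternatingPerms (n + 2), (X : ℝ[X]) ^ σ.negCount =
      (1 + X ^ 2) * derivative (∑ π ∈ oneCycleAlternatingPerms (n + 1), X ^ π.negCount) := by
  rw [sum_eq_sum_insert mem_oneCycleAlternatingPerms_succ, derivative_sum, Finset.mul_sum]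
  exact Finset.sum_congr rfl fun π _ => sum_signChanges_X_pow π

theorem mem_negIndices_iff_of_mem_signChanges {π : SignedPerm n} {e : SignedIndex n}
    (he : e ∈ π.signChanges) : e ∈ π.negIndices ↔ 0 < ((π.insert e).1 (first n) : ℤ) := by
  rw [mem_signChanges] at he
  rw [mem_negIndices, insert_first, coe_neg, neg_pos, coe_shift_neg]
  omega

theorem negIndices_subset_signChanges (π : SignedPerm n) : π.negIndices ⊆ π.signChanges :=
  fun _ he => mem_signChanges.2 (iff_of_true (mem_negIndices.1 he).1 (mem_negIndices.1 he).2)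

theorem sum_oneCycleAlternatingPerms_filter (n : ℕ) :
    ∑ σ ∈ (oneCycleAlternatingPerms (n + 2)).filter
        (fun σ => 0 < (σ.1 (SignedIndex.first (n + 1))).1), (X : ℝ[X]) ^ σ.negCount =
      derivative (∑ π ∈ oneCycleAlternatingPerms (n + 1), X ^ π.negCount) := by
  have h (σ) : σ ∈ (oneCycleAlternatingPerms (n + 2)).filter
      (fun σ => 0 < (σ.1 (SignedIndex.first (n + 1))).1) ↔
      ∃ π ∈ oneCycleAlternatingPerms (n + 1), ∃ e ∈ π.negIndices, π.insert e = σ := by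
    rw [Finset.mem_filter, mem_oneCycleAlternatingPerms_succ]
    constructor
    · rintro ⟨⟨π, hπ, e, he, rfl⟩, hpos⟩
      exact ⟨π, hπ, e, (mem_negIndices_iff_of_mem_signChanges he).2 hpos, rfl⟩
    · rintro ⟨π, hπ, e, he, rfl⟩
      have he' := negIndices_subset_signChanges π he
      exact ⟨⟨π, hπ, e, he', rfl⟩, (mem_negIndices_iff_of_mem_signChanges he').1 he⟩
  rw [sum_eq_sum_insert h, derivative_sum]
  exact Finset.sum_congr rfl fun π _ => sum_negIndices_X_pow π

/-- The term `X * _` stems from the permutations that exchange `1` and `-1`. -/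
theorem sum_cycleAlternatingPerms_succ (n : ℕ) :
    ∑ σ ∈ cycleAlternatingPerms (n + 1), (X : ℝ[X]) ^ σ.negCount =
      (1 + X ^ 2) * derivative (∑ π ∈ cycleAlternatingPerms n, X ^ π.negCount) +
        X * ∑ π ∈ cycleAlternatingPerms n, X ^ π.negCount := by
  rw [← Finset.sum_filter_add_sum_filter_not (cycleAlternatingPerms (n + 1))
    (fun σ => σ.1 (first n) = -first n), add_comm]
  refine congrArg₂ (· + ·) ?_ ?_
  · have h (σ) : σ ∈ (cycleAlternatingPerms (n + 1)).filter
        (fun σ => ¬ σ.1 (first n) = -first n) ↔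
        ∃ π ∈ cycleAlternatingPerms n, ∃ e ∈ π.signChanges, π.insert e = σ := by
      rw [Finset.mem_filter, mem_cycleAlternatingPerms]
      constructor
      · rintro ⟨hσ, h⟩
        obtain ⟨π, e, he, rfl⟩ := hσ.exists_insert_eq h
        exact ⟨π, mem_cycleAlternatingPerms.2 ((cycleAlternating_insert he).1 hσ), e, he, rfl⟩
      · rintro ⟨π, hπ, e, he, rfl⟩
        exact ⟨(cycleAlternating_insert he).2 (mem_cycleAlternatingPerms.1 hπ),
          insert_first_ne_neg π e⟩
    rw [sum_eq_sum_insert h, derivative_sum, Finset.mul_sum]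
    exact Finset.sum_congr rfl fun π _ => sum_signChanges_X_pow π
  · rw [Finset.mul_sum]
    refine (Finset.sum_bij (fun π _ => π.extend) (fun π hπ => ?_)
      (fun _ _ _ _ h => extend_injective h) (fun σ hσ => ?_) fun π _ => ?_).symm
    · rw [Finset.mem_filter, mem_cycleAlternatingPerms, cycleAlternating_extend]
      exact ⟨mem_cycleAlternatingPerms.1 hπ, extend_first π⟩
    · obtain ⟨h₁, h₂⟩ := Finset.mem_filter.1 hσ
      obtain ⟨π, rfl⟩ := exists_extend_eq h₂
      rw [mem_cycleAlternatingPerms, cycleAlternating_extend] at h₁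
      exact ⟨π, mem_cycleAlternatingPerms.2 h₁, rfl⟩
    · rw [negCount_extend, pow_succ']

theorem sum_cycleAlternatingPerms_zero :
    ∑ π ∈ cycleAlternatingPerms 0, (X : ℝ[X]) ^ π.negCount = 1 := by
  have : Unique (SignedPerm 0) := ⟨⟨⟨1, isEmptyElim⟩⟩, fun π =>
    Subtype.ext (Subsingleton.elim _ _)⟩
  have h : cycleAlternatingPerms 0 = {default} := by
    ext π
    simp [mem_cycleAlternatingPerms, CycleAlternating, Unique.eq_default π]
  rw [h, Finset.sum_singleton, negCount, Finset.univ_eq_empty]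
  simp

/-- The only alternating permutation of size one exchanges `1` and `-1`. -/
theorem sum_oneCycleAlternatingPerms_one :
    ∑ π ∈ oneCycleAlternatingPerms 1, (X : ℝ[X]) ^ π.negCount = X := by
  have hind (σ : SignedPerm 1) : σ.Indecomposable := by
    intro S hneg _ i j hi
    have h (i) : S i ↔ S (first 0) := by
      obtain rfl | rfl | ⟨i, rfl⟩ := cases_shift i
      · rfl
      · exact hneg _
      · exact isEmptyElim i
    rwa [h, ← h i]
  have h : oneCycleAlternatingPerms (0 + 1) = cycleAlternatingPerms (0 + 1) := by
    ext σ
    rw [mem_oneCycleAlternatingPerms, mem_cycleAlternatingPerms, and_iff_left (hind σ)]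
  have := sum_cycleAlternatingPerms_succ 0
  rw [sum_cycleAlternatingPerms_zero] at this
  simpa [← h] using this

end SignedPerm

/-! ### The derivative polynomials as generating functions -/

open SignedPerm

theorem isTanDerivPoly_sum (n : ℕ) : IsTanDerivPoly n
    (∑ π ∈ oneCycleAlternatingPerms (n + 1), (X : ℝ[X]) ^ π.negCount) := by
  induction n with
  | zero =>
    rw [sum_oneCycleAlternatingPerms_one]
    exact isTanDerivPoly_zero
  | succ n ih =>
    rw [sum_oneCycleAlternatingPerms_succ]
    exact ih.succ

theorem isSecPowDerivPoly_one_sum (n : ℕ) : IsSecPowDerivPoly 1 n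
    (∑ π ∈ cycleAlternatingPerms n, (X : ℝ[X]) ^ π.negCount) := by
  induction n with
  | zero =>
    rw [sum_cycleAlternatingPerms_zero]
    exact isSecPowDerivPoly_zero 1
  | succ n ih =>
    rw [sum_cycleAlternatingPerms_succ]
    simpa using ih.succ

theorem isSecPowDerivPoly_two_sum (n : ℕ) : IsSecPowDerivPoly 2 n
    (∑ π ∈ (oneCycleAlternatingPerms (n + 2)).filter
      (fun π => 0 < (π.1 (SignedIndex.first (n + 1))).1), (X : ℝ[X]) ^ π.negCount) := by
  rw [sum_oneCycleAlternatingPerms_filter]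
  exact (isTanDerivPoly_sum n).isSecPowDerivPoly_two

theorem mainTheorem2 (n : ℕ) :
    (∀ P : ℝ[X], IsTanDerivPoly n P ↔
      P = ∑ π ∈ oneCycleAlternatingPerms (n + 1), (X : ℝ[X]) ^ π.negCount) ∧
    (∀ Q : ℝ[X], IsSecPowDerivPoly 1 n Q ↔
      Q = ∑ π ∈ cycleAlternatingPerms n, (X : ℝ[X]) ^ π.negCount) ∧
    (∀ R : ℝ[X], IsSecPowDerivPoly 2 n R ↔
      R = ∑ π ∈ (oneCycleAlternatingPerms (n + 2)).filter
            (fun π => 0 < (π.1 (SignedIndex.first (n + 1))).1),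
          (X : ℝ[X]) ^ π.negCount) :=
  ⟨isTanDerivPoly_iff (isTanDerivPoly_sum n),
    isSecPowDerivPoly_iff (isSecPowDerivPoly_one_sum n),
    isSecPowDerivPoly_iff (isSecPowDerivPoly_two_sum n)⟩
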